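/- Let $K$ be a field (of any characteristic) and let $E$ be an elliptic curve over $K$, given by a Weierstrass equation. Let $\Omega$ be an algebraic closure of $K$, or more generally any algebraically closed field, and let $i \colon K \to \Omega$ be any field embedding. Let $L$ be a finite extension of $K$, with inseparable degree $[L:K]_{\mathrm{ins}}$, and let $\operatorname{Hom}_i(L,\Omega)$ be the (finite) set of field embeddings of $L$ into $\Omega$ that extend $i$. For $P \in E(L)$ and $j \in \operatorname{Hom}_i(L,\Omega)$, let $P^j$ denote the point of $E(\Omega)$ obtained by applying $j$ to the coordinates of $P$, where $E$ is viewed over $\Omega$ through $i$; for $T\in E(K)$, define $T^i\in E(\Omega)$ similarly. Then, for every $P \in E(L)$, the point $$R = [L:K]_{\mathrm{ins}} \sum_{j \in \operatorname{Hom}_i(L,\Omega)} P^j \in E(\Omega),$$ where the sum and the multiple are taken in the group law of $E$, lies in $E\big(i(K)\big)$; that is, $R$ is the point at infinity or both of its coordinates lie in $i(K)$. Consequently there is exactly one point $T \in E(K)$ such that $T^i = R$, so that the trace $\operatorname{Tr}(L/K,i,P) := T$ is well defined. -/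

import Mathlib

namespace EllTrace

open WeierstrassCurve

/-- The map `T ↦ T^f` from `E(K)` to the points over `F` of the curve `E^f` obtained from `E` by
applying the embedding `f : K → F` to the coefficients:
`(x, y)` goes to `(f x, f y)`, and `O` goes to `O`. -/
def pointMap {K F : Type*} [Field K] [Field F] (E : WeierstrassCurve K) (f : K →+* F) :
    E.toAffine.Point → (E.map f).toAffine.Point
  | .zero => .zero
  | .some x y h => .some (f x) (f y) ((E.toAffine.map_nonsingular f.injective x y).mpr h)

/-- The points of a Weierstrass curve over `F` which are defined over the subfield `k` of `F`:
the point at infinity `O`, and the affine points whose two coordinates lie in `k`. -/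
def pointsOver {F : Type*} [Field F] (W : WeierstrassCurve F) (k : Subfield F) :
    Set W.toAffine.Point :=
  {R | R = 0 ∨ ∃ (x y : F) (h : W.toAffine.Nonsingular x y), x ∈ k ∧ y ∈ k ∧ R = .some x y h}

/-- The point `[L:K]_ins • ∑ j, P^j` of `E` over `Ω`, where `j` ranges over the embeddings of `L`
into `Ω` which extend `i`. Inside this definition `Ω` is a `K`-algebra through `i`, so that these
embeddings are the `K`-algebra morphisms from `L` to `Ω`, and the base change of `E` to `Ω` is
`E.map i`. -/
noncomputable def traceSum {K L Ω : Type*} [Field K] [Field L] [Field Ω]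
    [DecidableEq L] [DecidableEq Ω] [Algebra K L] [FiniteDimensional K L]
    (E : WeierstrassCurve K) (i : K →+* Ω) (P : (E.baseChange L).toAffine.Point) :
    (E.map i).toAffine.Point :=
  letI : Algebra K Ω := i.toAlgebra
  (Field.finInsepDegree K L • ∑ j : L →ₐ[K] Ω, Affine.Point.map (W' := E.toAffine) j P :
    (E.baseChange Ω).toAffine.Point)

end EllTrace

/-! Let `S` be the separable closure of `K` in `L`. Embeddings of `L` into `Ω` correspond by
restriction to those of `S`, so `R` is the sum of the conjugates of `[L:S] • P`, once this point is
known to lie in `E(S)`; Galois descent then puts the sum in `E(K)` (`sum_map_mem_range_map`). For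
the purely inseparable step, evaluating the invariant differential along a derivation `D` is
additive in the point (`DifferentialAtPoint.add`). In characteristic `p` it vanishes on `p • P`,
whose coordinates are therefore constants of `D`. Descending through fields of constants reaches `S`
(`finrank_nsmul_mem_range_map`). -/

namespace EllTrace

universe u

open WeierstrassCurve

/-! ### Additivity of the invariant differential. -/

section InvariantDifferential

variable {R L : Type*} [CommRing R] [Field L] [Algebra R L] (D : Derivation R L L)

/-- The derivation `D` takes the value `d` on the invariant differential
`dx / (2y + a₁x + a₃) = dy / (3x² + 2a₂x + a₄ - a₁y)` of `W` at `(x, y)`. -/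
def DifferentialAt (W : WeierstrassCurve L) (d x y : L) : Prop :=
  D x = d * (2 * y + W.a₁ * x + W.a₃) ∧
    D y = d * (3 * x ^ 2 + 2 * W.a₂ * x + W.a₄ - W.a₁ * y)

/-- The derivation `D` kills the coefficients of `W`. -/
structure IsConstant (W : WeierstrassCurve L) : Prop where
  a₁ : D W.a₁ = 0
  a₂ : D W.a₂ = 0
  a₃ : D W.a₃ = 0
  a₄ : D W.a₄ = 0
  a₆ : D W.a₆ = 0

/-- The derivation `D` takes the value `d` on the invariant differential of `W` at a point. -/
def DifferentialAtPoint (W : WeierstrassCurve L) (d : L) : W.toAffine.Point → Prop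
  | .zero => d = 0
  | .some x y _ => DifferentialAt D W d x y

variable {D} {W : WeierstrassCurve L}

lemma two_mul_derivation (x : L) : D (2 * x) = 2 * D x := by
  rw [two_mul, map_add, two_mul]

lemma DifferentialAt.neg (hW : IsConstant D W) {d x y : L} (h : DifferentialAt D W d x y) :
    DifferentialAt D W (-d) x (W.toAffine.negY x y) := by
  obtain ⟨hx, hy⟩ := h
  refine ⟨by rw [hx, Affine.negY]; ring, ?_⟩
  simp only [Affine.negY, map_sub, map_neg, Derivation.leibniz, smul_eq_mul, hx, hy, hW.a₁, hW.a₃]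
  ring

lemma DifferentialAt.unique {d e x y : L} (h : W.toAffine.Nonsingular x y)
    (hd : DifferentialAt D W d x y) (he : DifferentialAt D W e x y) : d = e := by
  rcases ((Affine.nonsingular_iff' ..).mp h).2 with h | h
  · refine mul_right_cancel₀ h ?_
    linear_combination hd.2 - he.2
  · refine mul_right_cancel₀ h ?_
    linear_combination he.1 - hd.1

lemma exists_differentialAt (hW : IsConstant D W) {x y : L} (h : W.toAffine.Nonsingular x y) :
    ∃ d, DifferentialAt D W d x y := by
  obtain ⟨heq, hs⟩ := (Affine.nonsingular_iff' ..).mp h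
  have key : (2 * y + W.a₁ * x + W.a₃) * D y =
      (3 * x ^ 2 + 2 * W.a₂ * x + W.a₄ - W.a₁ * y) * D x := by
    have := congr_arg D ((Affine.equation_iff ..).mp heq)
    simp only [pow_succ, pow_zero, one_mul, map_add, Derivation.leibniz, smul_eq_mul, hW.a₁, hW.a₂,
      hW.a₃, hW.a₄, hW.a₆] at this
    linear_combination this
  rcases hs with h | h
  · have h' : 3 * x ^ 2 + 2 * W.a₂ * x + W.a₄ - W.a₁ * y ≠ 0 := by
      rwa [← neg_ne_zero, neg_sub]
    refine ⟨D y / (3 * x ^ 2 + 2 * W.a₂ * x + W.a₄ - W.a₁ * y), ?_, (div_mul_cancel₀ _ h').symm⟩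
    rw [div_mul_eq_mul_div, eq_div_iff h']
    linear_combination -key
  · refine ⟨D x / (2 * y + W.a₁ * x + W.a₃), (div_mul_cancel₀ _ h).symm, ?_⟩
    rw [div_mul_eq_mul_div, eq_div_iff h]
    linear_combination key

/-- Common to chord and tangent: the left sides of `hx` and `hy` are the derivatives of the
coordinates of the third collinear point. The value there is `-d`, and negation gives `d` at the
sum. -/
lemma DifferentialAt.addX (hW : IsConstant D W) {d x₁ x₂ y₁ ℓ : L}
    (hx : (2 * ℓ + W.a₁) * D ℓ - D x₁ - D x₂ =
      -d * (2 * W.toAffine.negAddY x₁ x₂ y₁ ℓ + W.a₁ * W.toAffine.addX x₁ x₂ ℓ + W.a₃))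
    (hy : D ℓ * (W.toAffine.addX x₁ x₂ ℓ - x₁) + ℓ *
      (-d * (2 * W.toAffine.negAddY x₁ x₂ y₁ ℓ + W.a₁ * W.toAffine.addX x₁ x₂ ℓ + W.a₃) - D x₁) +
        D y₁ = -d * (3 * W.toAffine.addX x₁ x₂ ℓ ^ 2 + 2 * W.a₂ * W.toAffine.addX x₁ x₂ ℓ + W.a₄ -
          W.a₁ * W.toAffine.negAddY x₁ x₂ y₁ ℓ)) :
    DifferentialAt D W d (W.toAffine.addX x₁ x₂ ℓ) (W.toAffine.addY x₁ x₂ y₁ ℓ) := by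
  have hX : D (W.toAffine.addX x₁ x₂ ℓ) =
      -d * (2 * W.toAffine.negAddY x₁ x₂ y₁ ℓ + W.a₁ * W.toAffine.addX x₁ x₂ ℓ + W.a₃) := by
    rw [← hx]
    simp only [Affine.addX, map_sub, map_add, pow_two, Derivation.leibniz, smul_eq_mul, hW.a₁,
      hW.a₂]
    ring
  have hY : DifferentialAt D W (-d) (W.toAffine.addX x₁ x₂ ℓ)
      (W.toAffine.negAddY x₁ x₂ y₁ ℓ) := by
    refine ⟨hX, ?_⟩
    rw [← hy]
    conv_lhs => rw [Affine.negAddY]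
    simp only [map_sub, map_add, Derivation.leibniz, smul_eq_mul, hX]
    ring
  simpa only [neg_neg, Affine.addY] using hY.neg hW

lemma DifferentialAt.add_of_X_ne (hW : IsConstant D W) {d e x₁ x₂ y₁ y₂ ℓ : L}
    (h₁ : W.toAffine.Equation x₁ y₁) (h₂ : W.toAffine.Equation x₂ y₂) (hx : x₁ ≠ x₂)
    (hℓ : ℓ * (x₁ - x₂) = y₁ - y₂)
    (hd : DifferentialAt D W d x₁ y₁) (he : DifferentialAt D W e x₂ y₂) :
    DifferentialAt D W (d + e) (W.toAffine.addX x₁ x₂ ℓ) (W.toAffine.addY x₁ x₂ y₁ ℓ) := by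
  have hu : x₁ - x₂ ≠ 0 := sub_ne_zero.mpr hx
  rw [Affine.equation_iff] at h₁ h₂
  have hm : D ℓ * (x₁ - x₂) = D y₁ - D y₂ - ℓ * (D x₁ - D x₂) := by
    have := congr_arg D hℓ
    simp only [map_sub, Derivation.leibniz, smul_eq_mul] at this
    linear_combination this
  obtain ⟨hx₁, hy₁⟩ := hd
  obtain ⟨hx₂, hy₂⟩ := he
  obtain rfl : y₂ = y₁ - ℓ * (x₁ - x₂) := by linear_combination hℓ
  -- Subtracting the two curve equations and cancelling `x₁ - x₂` solves for `a₄`; both goals then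
  -- become multiples of `hm`.
  have ha : W.a₄ = (2 * y₁ - ℓ * (x₁ - x₂)) * ℓ + W.a₁ * (x₁ * ℓ + (y₁ - ℓ * (x₁ - x₂))) +
      W.a₃ * ℓ - (x₁ ^ 2 + x₁ * x₂ + x₂ ^ 2) - W.a₂ * (x₁ + x₂) := by
    refine mul_right_cancel₀ hu ?_
    linear_combination h₂ - h₁
  rw [hx₁, hx₂, hy₁, hy₂, ha] at hm
  refine DifferentialAt.addX hW ?_ ?_ <;> refine mul_right_cancel₀ hu ?_
  · rw [hx₁, hx₂]
    simp only [Affine.negAddY, Affine.addX]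
    linear_combination (2 * ℓ + W.a₁) * hm
  · rw [hx₁, hy₁, ha]
    simp only [Affine.negAddY, Affine.addX]
    linear_combination (ℓ ^ 2 + W.a₁ * ℓ - W.a₂ - x₁ - x₂ - x₁) * hm

lemma DifferentialAt.add_self (hW : IsConstant D W) {d x y ℓ : L}
    (hw : 2 * y + W.a₁ * x + W.a₃ ≠ 0)
    (hℓ : ℓ * (2 * y + W.a₁ * x + W.a₃) = 3 * x ^ 2 + 2 * W.a₂ * x + W.a₄ - W.a₁ * y)
    (hd : DifferentialAt D W d x y) :
    DifferentialAt D W (d + d) (W.toAffine.addX x x ℓ) (W.toAffine.addY x x y ℓ) := by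
  obtain ⟨hx, hy⟩ := hd
  have hm : D ℓ * (2 * y + W.a₁ * x + W.a₃) =
      (6 * x + 2 * W.a₂) * D x - W.a₁ * D y - ℓ * (2 * D y + W.a₁ * D x) := by
    have := congr_arg D hℓ
    have h3 : D (3 * x ^ 2) = 6 * x * D x := by
      rw [show 3 * x ^ 2 = x * x + x * x + x * x by ring]
      simp only [map_add, Derivation.leibniz, smul_eq_mul]
      ring
    simp only [map_sub, map_add, Derivation.leibniz _ _ x, Derivation.leibniz _ ℓ,
      Derivation.leibniz _ W.a₁, mul_assoc (2 : L), two_mul_derivation, h3, smul_eq_mul, hW.a₁,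
      hW.a₂, hW.a₃, hW.a₄] at this
    linear_combination this
  have ha : W.a₄ = ℓ * (2 * y + W.a₁ * x + W.a₃) - 3 * x ^ 2 - 2 * W.a₂ * x + W.a₁ * y := by
    linear_combination -hℓ
  -- `D x` and `D y` are both multiples of `2y + a₁x + a₃`, which therefore cancels.
  have hm' : D ℓ = d * (6 * x + 2 * W.a₂ - W.a₁ * ℓ - 2 * ℓ ^ 2 - ℓ * W.a₁) := by
    refine mul_right_cancel₀ hw ?_
    rw [hm, hx, hy, ha]
    ring
  refine DifferentialAt.addX hW ?_ ?_
  · rw [hx, hm']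
    simp only [Affine.negAddY, Affine.addX]
    ring
  · rw [hx, hy, hm', ha]
    simp only [Affine.negAddY, Affine.addX]
    ring

lemma DifferentialAtPoint.add [DecidableEq L] (hW : IsConstant D W) {d e : L}
    {P Q : W.toAffine.Point}
    (hd : DifferentialAtPoint D W d P) (he : DifferentialAtPoint D W e Q) :
    DifferentialAtPoint D W (d + e) (P + Q) := by
  rcases P with _ | ⟨x₁, y₁, h₁⟩
  · obtain rfl : d = 0 := hd
    rw [zero_add]
    exact (zero_add Q).symm ▸ he
  rcases Q with _ | ⟨x₂, y₂, h₂⟩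
  · obtain rfl : e = 0 := he
    rw [add_zero]
    exact (add_zero (Affine.Point.some x₁ y₁ h₁)).symm ▸ hd
  by_cases hxy : x₁ = x₂ ∧ y₁ = W.toAffine.negY x₂ y₂
  · rw [Affine.Point.add_of_Y_eq hxy.1 hxy.2]
    obtain ⟨rfl, rfl⟩ := hxy
    have : d = -e := DifferentialAt.unique h₁ hd (DifferentialAt.neg hW he)
    exact this ▸ neg_add_cancel e
  rw [Affine.Point.add_some hxy]
  by_cases hx : x₁ = x₂
  · subst hx
    have hy : y₁ ≠ W.toAffine.negY x₁ y₂ := fun h => hxy ⟨rfl, h⟩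
    obtain rfl := Affine.Y_eq_of_Y_ne h₁.1 h₂.1 rfl hy
    obtain rfl := DifferentialAt.unique h₁ hd he
    have hw : y₁ - W.toAffine.negY x₁ y₁ ≠ 0 := sub_ne_zero.mpr hy
    have hw' : y₁ - W.toAffine.negY x₁ y₁ = 2 * y₁ + W.a₁ * x₁ + W.a₃ := by
      rw [Affine.negY]; ring
    refine DifferentialAt.add_self hW (hw' ▸ hw) ?_ hd
    rw [← hw', Affine.slope_of_Y_ne rfl hy, div_mul_cancel₀ _ hw]
  · refine DifferentialAt.add_of_X_ne hW h₁.1 h₂.1 hx ?_ hd he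
    rw [Affine.slope_of_X_ne hx, div_mul_cancel₀ _ (sub_ne_zero.mpr hx)]

lemma exists_differentialAtPoint (hW : IsConstant D W) (P : W.toAffine.Point) :
    ∃ d, DifferentialAtPoint D W d P := by
  rcases P with _ | ⟨x, y, h⟩
  · exact ⟨0, rfl⟩
  · exact exists_differentialAt hW h

lemma DifferentialAtPoint.nsmul [DecidableEq L] (hW : IsConstant D W) {d : L}
    {P : W.toAffine.Point} (hd : DifferentialAtPoint D W d P) (n : ℕ) :
    DifferentialAtPoint D W (n * d) (n • P) := by
  induction n with
  | zero => rw [Nat.cast_zero, zero_mul, zero_nsmul]; exact rfl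
  | succ n ih => rw [Nat.cast_succ, add_mul, one_mul, succ_nsmul]; exact ih.add hW hd

/-- In characteristic `p`, a derivation kills the coordinates of any multiple of `p • P`. -/
lemma differentialAtPoint_zero_nsmul [DecidableEq L] (hW : IsConstant D W) {n : ℕ}
    (hn : (n : L) = 0) (P : W.toAffine.Point) : DifferentialAtPoint D W 0 (n • P) := by
  obtain ⟨d, hd⟩ := exists_differentialAtPoint hW P
  simpa only [hn, zero_mul] using hd.nsmul hW n

end InvariantDifferential

/-! ### Purely inseparable descent. -/

/-- The field of constants of a derivation of a field extension. -/
def constants {F L : Type*} [Field F] [Field L] [Algebra F L] (D : Derivation F L L) :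
    IntermediateField F L where
  carrier := {x | D x = 0}
  mul_mem' {a b} ha hb := by
    rw [Set.mem_ofPred_eq] at *
    rw [Derivation.leibniz, ha, hb, smul_zero, smul_zero, add_zero]
  add_mem' {a b} ha hb := by
    rw [Set.mem_ofPred_eq] at *
    rw [map_add, ha, hb, add_zero]
  algebraMap_mem' := D.map_algebraMap
  inv_mem' a ha := by
    rw [Set.mem_ofPred_eq] at *
    rw [Derivation.leibniz_inv, ha, smul_zero]

lemma mem_constants {F L : Type*} [Field F] [Field L] [Algebra F L] {D : Derivation F L L} {x : L} :
    x ∈ constants D ↔ D x = 0 :=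
  Iff.rfl

/-- Inseparability makes the Kähler differentials nonzero; a linear form on them, composed with the
universal derivation, gives `D`. -/
lemma exists_derivation_ne_zero {F L : Type u} [Field F] [Field L] [Algebra F L]
    [FiniteDimensional F L] (h : ¬ Algebra.IsSeparable F L) : ∃ D : Derivation F L L, D ≠ 0 := by
  by_contra! hD
  refine h ((Algebra.FormallyUnramified.iff_isSeparable F L).mp ⟨?_⟩)
  refine subsingleton_of_forall_eq 0 fun ω => ?_
  rw [← Module.forall_dual_apply_eq_zero_iff L]
  intro f
  have hf : f.compDer (KaehlerDifferential.D F L) = 0 := hD _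
  have hf' : f = 0 := by
    refine LinearMap.ext_on (KaehlerDifferential.span_range_derivation F L) ?_
    rintro _ ⟨x, rfl⟩
    exact congr($hf x)
  rw [hf', LinearMap.zero_apply]

lemma mem_range_map_of_coord {K F L : Type*} [Field K] [Field F] [Field L] [Algebra K F]
    [Algebra K L] [DecidableEq F] [DecidableEq L] {E : WeierstrassCurve K} (f : F →ₐ[K] L) {x y : L}
    (h : (E.baseChange L).toAffine.Nonsingular x y) (hx : x ∈ Set.range f) (hy : y ∈ Set.range f) :
    Affine.Point.some x y h ∈ (Affine.Point.map (W' := E.toAffine) f).range := by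
  obtain ⟨x, rfl⟩ := hx
  obtain ⟨y, rfl⟩ := hy
  exact ⟨.some x y ((E.toAffine.baseChange_nonsingular f.injective ..).mp h), rfl⟩

lemma isConstant_baseChange {K F L : Type*} [Field K] [Field F] [Field L] [Algebra K F]
    [Algebra K L] [Algebra F L] [IsScalarTower K F L] (E : WeierstrassCurve K)
    (D : Derivation F L L) : IsConstant D (E.baseChange L) := by
  have h (a : K) : D (algebraMap K L a) = 0 := by
    rw [IsScalarTower.algebraMap_apply K F L, D.map_algebraMap]
  exact ⟨h _, h _, h _, h _, h _⟩

/-- A multiple of a point by a multiple of the characteristic is defined over the constants of any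
derivation. -/
lemma nsmul_mem_range_map_constants {K F L : Type*} [Field K] [Field F] [Field L] [DecidableEq L]
    [Algebra K F] [Algebra K L] [Algebra F L] [IsScalarTower K F L] (E : WeierstrassCurve K)
    (D : Derivation F L L) [DecidableEq (constants D)] {n : ℕ} (hn : (n : L) = 0)
    (P : (E.baseChange L).toAffine.Point) :
    n • P ∈ (Affine.Point.map (W' := E.toAffine)
      ((constants D).val.restrictScalars K)).range := by
  have h := differentialAtPoint_zero_nsmul (isConstant_baseChange E D) hn P
  generalize n • P = Q at h
  rcases Q with _ | ⟨x, y, hxy⟩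
  · exact zero_mem _
  · exact mem_range_map_of_coord _ hxy ⟨⟨x, h.1.trans (zero_mul _)⟩, rfl⟩
      ⟨⟨y, h.2.trans (zero_mul _)⟩, rfl⟩

lemma constants_eq_top_iff {F L : Type*} [Field F] [Field L] [Algebra F L] {D : Derivation F L L} :
    constants D = ⊤ ↔ D = 0 := by
  refine ⟨fun h => Derivation.ext fun x => ?_, fun h => top_le_iff.mp fun x _ => ?_⟩
  · exact mem_constants.mp (h ▸ IntermediateField.mem_top)
  · rw [mem_constants, h, Derivation.zero_apply]

lemma cast_finrank_eq_zero_of_isPurelyInseparable {F L : Type*} [Field F] [Field L] [Algebra F L]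
    [FiniteDimensional F L] [IsPurelyInseparable F L] (h : Module.finrank F L ≠ 1) :
    (Module.finrank F L : L) = 0 := by
  obtain ⟨p, hp⟩ := ExpChar.exists F
  obtain ⟨k, hk⟩ := IsPurelyInseparable.finrank_eq_pow (F := F) L p
  have hk0 : k ≠ 0 := by
    rintro rfl
    exact h (hk.trans (pow_zero p))
  rcases hp with _ | hp
  · exact absurd (hk.trans (one_pow k)) h
  · have : CharP L p := charP_of_injective_algebraMap (algebraMap F L).injective p
    rw [hk, Nat.cast_pow, CharP.cast_eq_zero, zero_pow hk0]

/-- If `L` is a finite purely inseparable extension of `F`, then the multiple of a point over `L`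
by `[L : F]` is defined over `F`. -/
theorem finrank_nsmul_mem_range_map {K : Type*} {F L : Type u} [Field K] [Field F] [Field L]
    [DecidableEq F] [DecidableEq L] [Algebra K F] [Algebra K L] [Algebra F L] [IsScalarTower K F L]
    [FiniteDimensional F L] [IsPurelyInseparable F L] (E : WeierstrassCurve K)
    (P : (E.baseChange L).toAffine.Point) :
    Module.finrank F L • P ∈
      (Affine.Point.map (W' := E.toAffine) (IsScalarTower.toAlgHom K F L)).range := by
  induction hn : Module.finrank F L using Nat.strong_induction_on generalizing L with
  | _ n ih =>
  by_cases hsep : Algebra.IsSeparable F L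
  · have hbij := IsPurelyInseparable.bijective_algebraMap_of_isSeparable F L
    refine nsmul_mem ?_ n
    rcases P with _ | ⟨x, y, h⟩
    · exact zero_mem _
    · exact mem_range_map_of_coord _ h (hbij.2 x) (hbij.2 y)
  classical
  obtain ⟨D, hD⟩ := exists_derivation_ne_zero hsep
  have h1 : Module.finrank (constants D) L ≠ 1 := fun h =>
    hD (constants_eq_top_iff.mp (IntermediateField.finrank_eq_one_iff_eq_top.mp h))
  obtain ⟨Q, hQ⟩ := nsmul_mem_range_map_constants E D
    (cast_finrank_eq_zero_of_isPurelyInseparable h1) P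
  -- Since `D ≠ 0`, its constants form a proper subfield, so the degree over `F` drops and induction
  -- applies to `Q`.
  have hmul : Module.finrank F (constants D) * Module.finrank (constants D) L = n :=
    (Module.finrank_mul_finrank ..).trans hn
  have hlt : Module.finrank F (constants D) < n := by
    have h0 : 0 < Module.finrank F (constants D) := Module.finrank_pos
    have h2 : 0 < Module.finrank (constants D) L := Module.finrank_pos
    rw [← hmul]
    exact lt_mul_of_one_lt_right h0 (by lia)
  obtain ⟨T, hT⟩ := ih _ hlt Q rfl
  refine ⟨T, ?_⟩
  rw [← hmul, mul_nsmul', ← hQ, ← map_nsmul, ← hT, Affine.Point.map_map]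
  rfl

/-! ### Separable descent by Galois theory. -/

/-- The sum of the images of a point under all embeddings of a finite separable extension is
defined over the base field. -/
theorem sum_map_mem_range_map {K S Ω : Type*} [Field K] [Field S] [Field Ω] [DecidableEq K]
    [DecidableEq S] [DecidableEq Ω] [Algebra K S] [Algebra K Ω] [FiniteDimensional K S]
    [Algebra.IsSeparable K S] [IsSepClosed Ω] (E : WeierstrassCurve K)
    (Q : (E.baseChange S).toAffine.Point) :
    ∑ j : S →ₐ[K] Ω, Affine.Point.map (W' := E.toAffine) j Q ∈
      (Affine.Point.map (W' := E.toAffine) (Algebra.ofId K Ω)).range := by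
  classical
  let N := separableClosure K Ω
  have hmem (j : S →ₐ[K] Ω) (x : S) : j x ∈ N :=
    (map_mem_separableClosure_iff j).mpr (mem_separableClosure_iff.mpr
      (Algebra.IsSeparable.isSeparable K x))
  let e : (S →ₐ[K] N) ≃ (S →ₐ[K] Ω) :=
    { toFun := fun j => N.val.comp j
      invFun := fun j => j.codRestrict N.toSubalgebra (hmem j)
      left_inv := fun _ => rfl
      right_inv := fun _ => rfl }
  have hsum : ∑ j : S →ₐ[K] Ω, Affine.Point.map (W' := E.toAffine) j Q =
      Affine.Point.map (W' := E.toAffine) N.val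
        (∑ j : S →ₐ[K] N, Affine.Point.map (W' := E.toAffine) j Q) := by
    rw [map_sum, ← e.sum_comp]
    exact Finset.sum_congr rfl fun j _ => (Affine.Point.map_map j N.val Q).symm
  -- Composition with `σ` permutes the embeddings.
  have hfix (σ : N ≃ₐ[K] N) : Affine.Point.map (W' := E.toAffine) σ.toAlgHom
      (∑ j : S →ₐ[K] N, Affine.Point.map (W' := E.toAffine) j Q) =
        ∑ j : S →ₐ[K] N, Affine.Point.map (W' := E.toAffine) j Q := by
    rw [map_sum]
    exact Fintype.sum_equiv (AlgEquiv.refl.arrowCongr σ) _ _ fun j =>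
      Affine.Point.map_map j σ.toAlgHom Q
  have : IsGalois K N := IsSepClosure.isGalois
  suffices h : ∑ j : S →ₐ[K] N, Affine.Point.map (W' := E.toAffine) j Q ∈
      (Affine.Point.map (W' := E.toAffine) (Algebra.ofId K N)).range by
    obtain ⟨T, hT⟩ := h
    refine ⟨T, ?_⟩
    rw [hsum, ← hT, Affine.Point.map_map]
    rfl
  generalize ∑ j : S →ₐ[K] N, Affine.Point.map (W' := E.toAffine) j Q = R at hfix
  rcases R with _ | ⟨x, y, h⟩
  · exact zero_mem _
  · have hσ (σ : N ≃ₐ[K] N) : σ x = x ∧ σ y = y :=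
      (Affine.Point.some.injEq ..).mp (hfix σ)
    exact mem_range_map_of_coord _ h
      ((InfiniteGalois.mem_range_algebraMap_iff_fixed x).mpr fun σ => (hσ σ).1)
      ((InfiniteGalois.mem_range_algebraMap_iff_fixed y).mpr fun σ => (hσ σ).2)

/-- The restriction of embeddings to the separable closure is bijective. -/
lemma bijective_comp_val_separableClosure (K L Ω : Type*) [Field K] [Field L] [Field Ω]
    [Algebra K L] [Algebra K Ω] [FiniteDimensional K L] [IsAlgClosed Ω] :
    Function.Bijective fun j : L →ₐ[K] Ω => j.comp (separableClosure K L).val := by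
  constructor
  · intro j j' h
    let : Algebra (separableClosure K L) Ω := (j.comp (separableClosure K L).val).toAlgebra
    let f : L →ₐ[separableClosure K L] Ω := { j with commutes' := fun _ => rfl }
    let f' : L →ₐ[separableClosure K L] Ω :=
      { j' with commutes' := fun x => (DFunLike.congr_fun h x).symm }
    -- `L` is purely inseparable over the separable closure, so an embedding over it is unique.
    have hf : f = f' := Subsingleton.elim f f'
    exact AlgHom.ext fun x => DFunLike.congr_fun hf x
  · intro j
    let : Algebra (separableClosure K L) Ω := j.toAlgebra
    have : IsScalarTower K (separableClosure K L) Ω :=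
      IsScalarTower.of_algebraMap_eq fun x => (j.commutes x).symm
    let f : L →ₐ[separableClosure K L] Ω := IsAlgClosed.lift
    exact ⟨f.restrictScalars K, AlgHom.ext fun x => f.commutes x⟩

theorem finInsepDegree_nsmul_sum_map_mem_range_map {K L Ω : Type*} [Field K] [Field L] [Field Ω]
    [DecidableEq K] [DecidableEq L] [DecidableEq Ω] [Algebra K L] [Algebra K Ω]
    [FiniteDimensional K L] [IsAlgClosed Ω] (E : WeierstrassCurve K)
    (P : (E.baseChange L).toAffine.Point) :
    Field.finInsepDegree K L • ∑ j : L →ₐ[K] Ω, Affine.Point.map (W' := E.toAffine) j P ∈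
      (Affine.Point.map (W' := E.toAffine) (Algebra.ofId K Ω)).range := by
  classical
  obtain ⟨Q, hQ⟩ := finrank_nsmul_mem_range_map (F := separableClosure K L) E P
  convert sum_map_mem_range_map (Ω := Ω) E Q
  rw [← (bijective_comp_val_separableClosure K L Ω).sum_comp, Finset.smul_sum]
  refine Finset.sum_congr rfl fun j _ => ?_
  rw [← map_nsmul, Field.finInsepDegree, ← hQ, Affine.Point.map_map]
  rfl

/-! ### Return to coordinates and the embedding `i`. -/

lemma pointMap_injective {K F : Type*} [Field K] [Field F] (E : WeierstrassCurve K) (f : K →+* F) :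
    Function.Injective (pointMap E f) := by
  rintro (_ | ⟨x, y, h⟩) (_ | ⟨x', y', h'⟩) hT
  · rfl
  · cases hT
  · cases hT
  · obtain ⟨hx, hy⟩ := (Affine.Point.some.injEq ..).mp hT
    obtain rfl := f.injective hx
    obtain rfl := f.injective hy
    rfl

lemma pointMap_mem_pointsOver {K F : Type*} [Field K] [Field F] (E : WeierstrassCurve K)
    (f : K →+* F) (T : E.toAffine.Point) : pointMap E f T ∈ pointsOver (E.map f) f.fieldRange := by
  rcases T with _ | ⟨x, y, h⟩
  · exact .inl rfl
  · exact .inr ⟨_, _, _, ⟨x, rfl⟩, ⟨y, rfl⟩, rfl⟩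

lemma exists_pointMap_eq_traceSum {K L Ω : Type*} [Field K] [Field L] [Field Ω]
    [DecidableEq L] [DecidableEq Ω] [Algebra K L] [FiniteDimensional K L] [IsAlgClosed Ω]
    (E : WeierstrassCurve K) (i : K →+* Ω) (P : (E.baseChange L).toAffine.Point) :
    ∃ T : E.toAffine.Point, pointMap E i T = traceSum E i P := by
  classical
  let : Algebra K Ω := i.toAlgebra
  obtain ⟨T, hT⟩ := finInsepDegree_nsmul_sum_map_mem_range_map (Ω := Ω) E P
  rcases T with _ | ⟨x, y, h⟩
  · exact ⟨.zero, hT⟩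
  · exact ⟨.some x y h, hT⟩

end EllTrace

theorem proposition2 {K L Ω : Type*} [Field K] [Field L] [Field Ω]
    [DecidableEq L] [DecidableEq Ω]
    [Algebra K L] [FiniteDimensional K L] [IsAlgClosed Ω]
    (E : WeierstrassCurve K) [E.IsElliptic] (i : K →+* Ω)
    (P : (E.baseChange L).toAffine.Point) :
    EllTrace.traceSum E i P ∈ EllTrace.pointsOver (E.map i) i.fieldRange ∧
      ∃! T : E.toAffine.Point, EllTrace.pointMap E i T = EllTrace.traceSum E i P := by
  obtain ⟨T, hT⟩ := EllTrace.exists_pointMap_eq_traceSum E i P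
  rw [← hT]
  exact ⟨EllTrace.pointMap_mem_pointsOver E i T, T, rfl,
    fun _ h => EllTrace.pointMap_injective E i h⟩
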